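/- **Theorem.** Consider the quantifier-free theory BV of fixed-size bit-vectors (SMT-LIB signature: Boolean connectives, equality, if-then-else, bit-vector literals, concatenation, extraction, and the bitwise, arithmetic, shift and comparison operations, together with free constants). Relation symbols and connectives count as symbols of the signature $\Sigma$. A formula is *valid* if it is well-sorted and true under every interpretation of the free constants. An instance of the syntax-guided synthesis (SyGuS) problem over BV consists of a function symbol $f$ of some arity $k\ge 0$, a formula $\varphi$ over $\Sigma\cup\{f\}$, and a grammar $G$ generating terms in $T(\Sigma,\{x_1,\dots,x_k\})$, i.e. expressions built from the symbols of $\Sigma$ according to their arities and from the bound variables $x_1,\dots,x_k$; the expressions generated need not be well-sorted. The question is whether there is a term $w\in L(G)$ such that $\varphi\{w/f\}$ is valid, where $\varphi\{w/f\}$ arises from $\varphi$ by replacing every $f(s_1,\dots,s_k)$ by $w\{s_1/x_1,\dots,s_k/x_k\}$. This problem is undecidable in each of the following cases: 1. $G$ ranges over the context-free grammars all of whose words are terms in $T(\Sigma,\{x_1,\dots,x_k\})$, written in prefix notation; 2. $G$ ranges over the BV-compatible regular tree grammars, i.e. those with productions $A\to g(t_1,\dots,t_n)$, where $g$ is an $n$-ary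 symbol of $\Sigma$ or (with $n=0$) one of $x_1,\dots,x_k$, and each $t_i$ is a nonterminal or a term in $T(\Sigma,\{x_1,\dots,x_k\})$. In both cases this remains true if, besides $f$ and $x_1,\dots,x_k$, only the constants $0$ and $1$ (bit-vectors of width one), concatenation and equality may occur in $\varphi$ and $G$. Here undecidable means that there is no algorithm that halts with the correct yes/no answer on every instance of the class in question. -/

import Mathlib

namespace SyGuS

/-! ### The theory of fixed-size bit-vectors

Signature of the SMT-LIB theories `Core` and `FixedSizeBitVectors`, together with free constants.
Relation symbols and connectives are function symbols with values of sort `Bool`. -/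

/-- The ranked alphabet: `BVFun n` is the set of symbols of arity `n`. Bit-vector widths are
positive. -/
inductive BVFun : ℕ → Type
  /-- the free Boolean constant with the given name -/
  | boolConst (name : ℕ) : BVFun 0
  /-- the free bit-vector constant with the given name and width -/
  | bvConst (name : ℕ) (w : ℕ+) : BVFun 0
  | tt : BVFun 0
  | ff : BVFun 0
  | not : BVFun 1
  | imp : BVFun 2
  | and : BVFun 2
  | or : BVFun 2
  | xor : BVFun 2
  | eq : BVFun 2
  | distinct : BVFun 2
  | ite : BVFun 3
  /-- a bit-vector literal such as `#b0110` -/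
  | lit (w : ℕ+) (v : BitVec w) : BVFun 0
  /-- the first argument gives the most significant bits -/
  | concat : BVFun 2
  /-- the bits `hi, hi - 1, …, lo` of the argument -/
  | extract (hi lo : ℕ) : BVFun 1
  | bvnot : BVFun 1
  | bvneg : BVFun 1
  | bvand : BVFun 2
  | bvor : BVFun 2
  | bvadd : BVFun 2
  | bvmul : BVFun 2
  | bvudiv : BVFun 2
  | bvurem : BVFun 2
  | bvshl : BVFun 2
  | bvlshr : BVFun 2
  | bvult : BVFun 2

/-- The signature of the theory of bit-vectors, as a first-order language. -/
abbrev BV : FirstOrder.Language := ⟨BVFun, fun _ => Empty⟩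

/-- Sorts: `Bool`, and bit-vectors of each width. -/
inductive Srt : Type
  | bool
  | bv (w : ℕ)

/-- The elements of a sort. -/
abbrev Srt.Carrier : Srt → Type
  | .bool => Bool
  | .bv w => BitVec w

/-- A value: an element of one of the sorts. -/
abbrev Val : Type := Σ σ : Srt, σ.Carrier

/-- Boolean values. -/
def Val.ofBool (b : Bool) : Val := ⟨.bool, b⟩

/-- Bit-vector values. -/
def Val.ofBV {w : ℕ} (x : BitVec w) : Val := ⟨.bv w, x⟩

/- In the operations below `none` is the result of applying a symbol to arguments of the wrong sorts.
Whether the result is `none` depends on the sorts of the arguments only, so that a term evaluates to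
`none` if and only if it is ill-sorted. -/

/-- Apply a unary Boolean operation. -/
def boolOp₁ (op : Bool → Bool) : Val → Option Val
  | ⟨.bool, a⟩ => some (.ofBool (op a))
  | _ => none

/-- Apply a binary Boolean operation. -/
def boolOp₂ (op : Bool → Bool → Bool) : Val → Val → Option Val
  | ⟨.bool, a⟩, ⟨.bool, b⟩ => some (.ofBool (op a b))
  | _, _ => none

/-- Apply a unary width-preserving bit-vector operation. -/
def bvOp₁ (op : ∀ w : ℕ, BitVec w → BitVec w) : Val → Option Val
  | ⟨.bv w, x⟩ => some (.ofBV (op w x))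
  | _ => none

/-- Apply a binary operation to two bit-vectors of the same width. -/
def bvOp₂ (op : ∀ w : ℕ, BitVec w → BitVec w → Val) : Val → Val → Option Val
  | ⟨.bv w, x⟩, ⟨.bv w', y⟩ => if h : w' = w then some (op w x (BitVec.cast h y)) else none
  | _, _ => none

/-- Concatenation of bit-vectors of any widths. -/
def concatOp : Val → Val → Option Val
  | ⟨.bv w, x⟩, ⟨.bv w', y⟩ => some (.ofBV (BitVec.append (n := w) (m := w') x y))
  | _, _ => none

/-- Extraction; it is well-sorted on width `w` if `w > hi ≥ lo`. -/
def extractOp (hi lo : ℕ) : Val → Option Val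
  | ⟨.bv w, x⟩ => if lo ≤ hi ∧ hi < w then some (.ofBV (BitVec.extractLsb hi lo x)) else none
  | _ => none

open Classical in
/-- Equality of two values of the same sort. -/
noncomputable def eqOp (a b : Val) : Option Val :=
  if a.1 = b.1 then some (.ofBool (decide (a = b))) else none

open Classical in
/-- If-then-else, both of whose branches have the same sort. -/
noncomputable def iteOp : Val → Val → Val → Option Val
  | ⟨.bool, c⟩, a, b => if a.1 = b.1 then some (bif c then a else b) else none
  | _, _, _ => none

/-- An interpretation of the free constants. -/
structure Interp where
  bool : ℕ → Bool
  bv : ℕ → (w : ℕ+) → BitVec w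

/-- The interpretation of the symbols. -/
noncomputable def BVFun.eval (ρ : Interp) : {n : ℕ} → BVFun n → (Fin n → Option Val) → Option Val
  | _, .boolConst x, _ => some (.ofBool (ρ.bool x))
  | _, .bvConst x w, _ => some (.ofBV (ρ.bv x w))
  | _, .tt, _ => some (.ofBool true)
  | _, .ff, _ => some (.ofBool false)
  | _, .lit _ v, _ => some (.ofBV v)
  | _, .not, a => (a 0).bind (boolOp₁ Bool.not)
  | _, .imp, a => (a 0).bind fun x => (a 1).bind fun y => boolOp₂ (fun p q => !p || q) x y
  | _, .and, a => (a 0).bind fun x => (a 1).bind fun y => boolOp₂ Bool.and x y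
  | _, .or, a => (a 0).bind fun x => (a 1).bind fun y => boolOp₂ Bool.or x y
  | _, .xor, a => (a 0).bind fun x => (a 1).bind fun y => boolOp₂ Bool.xor x y
  | _, .eq, a => (a 0).bind fun x => (a 1).bind fun y => eqOp x y
  | _, .distinct, a =>
      (a 0).bind fun x => (a 1).bind fun y => (eqOp x y).bind (boolOp₁ Bool.not)
  | _, .ite, a =>
      (a 0).bind fun x => (a 1).bind fun y => (a 2).bind fun z => iteOp x y z
  | _, .concat, a => (a 0).bind fun x => (a 1).bind fun y => concatOp x y
  | _, .extract hi lo, a => (a 0).bind (extractOp hi lo)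
  | _, .bvnot, a => (a 0).bind (bvOp₁ fun _ x => ~~~x)
  | _, .bvneg, a => (a 0).bind (bvOp₁ fun _ x => -x)
  | _, .bvand, a =>
      (a 0).bind fun x => (a 1).bind fun y => bvOp₂ (fun _ u v => .ofBV (u &&& v)) x y
  | _, .bvor, a =>
      (a 0).bind fun x => (a 1).bind fun y => bvOp₂ (fun _ u v => .ofBV (u ||| v)) x y
  | _, .bvadd, a =>
      (a 0).bind fun x => (a 1).bind fun y => bvOp₂ (fun _ u v => .ofBV (u + v)) x y
  | _, .bvmul, a =>
      (a 0).bind fun x => (a 1).bind fun y => bvOp₂ (fun _ u v => .ofBV (u * v)) x y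
  | _, .bvudiv, a =>
      (a 0).bind fun x => (a 1).bind fun y => bvOp₂ (fun _ u v => .ofBV (BitVec.smtUDiv u v)) x y
  | _, .bvurem, a =>
      (a 0).bind fun x => (a 1).bind fun y => bvOp₂ (fun _ u v => .ofBV (BitVec.umod u v)) x y
  | _, .bvshl, a =>
      (a 0).bind fun x => (a 1).bind fun y => bvOp₂ (fun _ u v => .ofBV (u <<< v)) x y
  | _, .bvlshr, a =>
      (a 0).bind fun x => (a 1).bind fun y => bvOp₂ (fun _ u v => .ofBV (u >>> v)) x y
  | _, .bvult, a =>
      (a 0).bind fun x => (a 1).bind fun y => bvOp₂ (fun _ u v => .ofBool (BitVec.ult u v)) x y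

/-- The models of the theory of bit-vectors: all symbols have their standard meaning, and the free
constants have an arbitrary one. -/
noncomputable abbrev bvModel (ρ : Interp) : BV.Structure (Option Val) where
  funMap := fun {_} g a => BVFun.eval ρ g a
  RelMap := fun r _ => Empty.elim r

/-- A formula is valid if it is well-sorted and true in all models. -/
def Valid (φ : BV.Term Empty) : Prop :=
  ∀ ρ : Interp, @FirstOrder.Language.Term.realize BV (Option Val) (bvModel ρ) Empty Empty.elim φ
    = some (.ofBool true)

/-! ### Specifications and second-order substitution -/

/-- The ranked alphabet whose only symbol is the function symbol `f` of arity `k`. -/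
inductive FSym (k : ℕ) : ℕ → Type
  | f : FSym k k

/-- The signature `{f}`, where `f` has arity `k`. -/
abbrev fLang (k : ℕ) : FirstOrder.Language := ⟨FSym k, fun _ => Empty⟩

/-- A specification: a formula over the signature of the theory extended by `f`. -/
abbrev Spec (k : ℕ) : Type := (BV.sum (fLang k)).Term Empty

/-- A candidate expression for `f`: a term in the bound variables `x₁, …, x_k`. -/
abbrev Cand (k : ℕ) : Type := BV.Term (Fin k)

/-- The second-order substitution `φ{w/f}`: each `f(s₁, …, s_k)` is replaced by
`w{s₁/x₁, …, s_k/x_k}`. -/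
def subst {k : ℕ} (w : Cand k) : Spec k → BV.Term Empty
  | .var a => .var a
  | .func (Sum.inl g) ts => .func g fun i => subst w (ts i)
  | .func (Sum.inr FSym.f) ts => FirstOrder.Language.Term.subst w fun i => subst w (ts i)

/-- The problem given by the specification `φ` and the set `L` of candidates has a solution. -/
def Solvable {k : ℕ} (φ : Spec k) (L : Set (Cand k)) : Prop :=
  ∃ w ∈ L, Valid (subst w φ)

/-! ### Instances with a context-free grammar -/

/-- The alphabet over which terms are written, in prefix notation. -/
abbrev Letter (k : ℕ) : Type := Fin k ⊕ (Σ n, BV.Functions n)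

/-- A problem with a context-free grammar, given by a start symbol and a list of productions; the
nonterminals are natural numbers, of which finitely many occur. -/
structure CFInstance where
  k : ℕ
  spec : Spec k
  start : ℕ
  rules : List (ContextFreeRule (Letter k) ℕ)

open Classical in
/-- The context-free grammar of an instance. -/
noncomputable def CFInstance.grammar (I : CFInstance) : ContextFreeGrammar (Letter I.k) :=
  ⟨ℕ, I.start, I.rules.toFinset⟩

/-- All the words that the grammar generates are (prefix notations of) terms. -/
def CFInstance.GeneratesTerms (I : CFInstance) : Prop :=
  ∀ s ∈ I.grammar.language, ∃ w : Cand I.k, w.listEncode = s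

/-- The problem has a solution. -/
def CFInstance.HasSolution (I : CFInstance) : Prop :=
  Solvable I.spec {w | w.listEncode ∈ I.grammar.language}

/-! ### Instances with a tree grammar -/

/-- The right-hand side of a production of a regular tree grammar: `g(t₁, …, t_n)`, where each `tᵢ`
is a nonterminal or a term without nonterminals. The bound variable `xᵢ` counts as a symbol of
arity `0`. All other symbols are, with their arities, those of the theory: the tree grammars are
compatible with it. -/
inductive TreeRhs (k : ℕ) : Type
  | boundVar (i : Fin k)
  | app {n : ℕ} (g : BV.Functions n) (ts : Fin n → ℕ ⊕ Cand k)

/-- A problem with a tree grammar; the nonterminals are natural numbers, of which finitely many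
occur. -/
structure TreeInstance where
  k : ℕ
  spec : Spec k
  start : ℕ
  rules : List (ℕ × TreeRhs k)

/-- `Generates R A w`: with the productions `R`, the tree `w` can be derived from the nonterminal
`A`. -/
inductive Generates {k : ℕ} (R : List (ℕ × TreeRhs k)) : ℕ → Cand k → Prop
  | boundVar {A : ℕ} {i : Fin k} (h : (A, TreeRhs.boundVar i) ∈ R) : Generates R A (.var i)
  | app {A n : ℕ} {g : BV.Functions n} {ts : Fin n → ℕ ⊕ Cand k} (us : Fin n → Cand k)
      (h : (A, TreeRhs.app g ts) ∈ R)
      (hN : ∀ i B, ts i = Sum.inl B → Generates R B (us i))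
      (hT : ∀ i t, ts i = Sum.inr t → us i = t) : Generates R A (.func g us)

/-- The problem has a solution. -/
def TreeInstance.HasSolution (I : TreeInstance) : Prop :=
  Solvable I.spec {w | Generates I.rules I.start w}

/-! ### The fragment with concatenation and equality only -/

/-- The symbols `0` and `1` (the bit-vectors of width one), concatenation, and equality. -/
def BVFun.IsConcatEq : {n : ℕ} → BVFun n → Prop
  | _, .lit w _ => w = 1
  | _, .concat => True
  | _, .eq => True
  | _, _ => False

/-- All function symbols in a term satisfy `S`. -/
def OnlySymbols {L : FirstOrder.Language.{0, 0}} {α : Type} (S : ∀ n, L.Functions n → Prop) :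
    L.Term α → Prop
  | .var _ => True
  | .func g ts => S _ g ∧ ∀ i, OnlySymbols S (ts i)

/-- The specification uses only `f` and the symbols of the fragment. -/
def SpecConcatEq {k : ℕ} (φ : Spec k) : Prop :=
  OnlySymbols (fun _ g => Sum.elim (fun g : BVFun _ => g.IsConcatEq) (fun _ => True) g) φ

/-- The specification and the grammar use only the symbols of the fragment. -/
def CFInstance.ConcatEq (I : CFInstance) : Prop :=
  SpecConcatEq I.spec ∧
    ∀ r ∈ I.rules, ∀ (n : ℕ) (g : BVFun n),
      Symbol.terminal (Sum.inr ⟨n, g⟩) ∈ r.output → g.IsConcatEq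

/-- The symbols in the right-hand side of a production belong to the fragment. -/
def TreeRhs.ConcatEq {k : ℕ} : TreeRhs k → Prop
  | .boundVar _ => True
  | .app g ts => BVFun.IsConcatEq g ∧
      ∀ i t, ts i = Sum.inr t → OnlySymbols (fun _ (g : BVFun _) => g.IsConcatEq) t

/-- The specification and the grammar use only the symbols of the fragment. -/
def TreeInstance.ConcatEq (I : TreeInstance) : Prop :=
  SpecConcatEq I.spec ∧ ∀ r ∈ I.rules, r.2.ConcatEq

/-! ### Codes of instances, and undecidability

Algorithms are partial recursive functions. They are given an instance written as a tuple of natural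
numbers and lists; terms are written in prefix notation. -/

/-- The code of a symbol of the theory. -/
def BVFun.code : {n : ℕ} → BVFun n → List ℕ
  | _, .boolConst x => [2, x]
  | _, .bvConst x w => [3, x, w]
  | _, .lit w v => [4, w, v.toNat]
  | _, .extract hi lo => [5, hi, lo]
  | _, .tt => [6]
  | _, .ff => [7]
  | _, .not => [8]
  | _, .imp => [9]
  | _, .and => [10]
  | _, .or => [11]
  | _, .xor => [12]
  | _, .eq => [13]
  | _, .distinct => [14]
  | _, .ite => [15]
  | _, .concat => [16]
  | _, .bvnot => [17]
  | _, .bvneg => [18]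
  | _, .bvand => [19]
  | _, .bvor => [20]
  | _, .bvadd => [21]
  | _, .bvmul => [22]
  | _, .bvudiv => [23]
  | _, .bvurem => [24]
  | _, .bvshl => [25]
  | _, .bvlshr => [26]
  | _, .bvult => [27]

/-- The code of a letter of a candidate expression. -/
def letterCode {k : ℕ} : Letter k → List ℕ
  | Sum.inl i => [0, i]
  | Sum.inr ⟨_, g⟩ => BVFun.code g

/-- The code of a letter of a specification. -/
def specLetterCode {k : ℕ} : Empty ⊕ (Σ n, (BV.sum (fLang k)).Functions n) → List ℕ
  | Sum.inl a => a.elim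
  | Sum.inr ⟨_, Sum.inl g⟩ => BVFun.code g
  | Sum.inr ⟨_, Sum.inr _⟩ => [1]

/-- The code of a candidate expression. -/
def candCode {k : ℕ} (w : Cand k) : List (List ℕ) := w.listEncode.map letterCode

/-- The code of a specification. -/
def specCode {k : ℕ} (φ : Spec k) : List (List ℕ) := φ.listEncode.map specLetterCode

/-- The code of a symbol in a context-free production. -/
def symbolCode {k : ℕ} : Symbol (Letter k) ℕ → ℕ ⊕ List ℕ
  | .nonterminal A => Sum.inl A
  | .terminal a => Sum.inr (letterCode a)

/-- The code of an instance with a context-free grammar. -/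
def CFInstance.code (I : CFInstance) :
    ℕ × List (List ℕ) × ℕ × List (ℕ × List (ℕ ⊕ List ℕ)) :=
  (I.k, specCode I.spec, I.start, I.rules.map fun r => (r.input, r.output.map symbolCode))

/-- The code of the right-hand side of a tree production. -/
def TreeRhs.code {k : ℕ} : TreeRhs k → List ℕ × List (ℕ ⊕ List (List ℕ))
  | .boundVar i => ([0, i], [])
  | .app g ts => (BVFun.code g, List.ofFn fun i => (ts i).map id candCode)

/-- The code of an instance with a tree grammar. -/
def TreeInstance.code (I : TreeInstance) :
    ℕ × List (List ℕ) × ℕ × List (ℕ × List ℕ × List (ℕ ⊕ List (List ℕ))) :=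
  (I.k, specCode I.spec, I.start, I.rules.map fun r => (r.1, r.2.code))

/-- The problem `P` is undecidable on the class `C` of instances: no partial recursive function
halts on (the code of) every instance in `C` with the right answer. -/
def Undecidable {ι γ : Type} [Primcodable γ] (code : ι → γ) (C P : ι → Prop) : Prop :=
  ¬ ∃ d : γ →. Bool, Partrec d ∧ ∀ I, C I → ∃ b ∈ d (code I), (b = true ↔ P I)

/-! The codes determine the instances. -/

theorem BVFun.code_inj {m n : ℕ} (a : BVFun m) (b : BVFun n) (h : a.code = b.code) :
    (⟨m, a⟩ : Σ n, BVFun n) = ⟨n, b⟩ := by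
  cases a <;> cases b <;> simp_all [BVFun.code]
  rename_i w v w' v'
  obtain ⟨h1, h2⟩ := h
  subst h1
  exact heq_of_eq (BitVec.eq_of_toNat_eq h2)

theorem letterCode_injective (k : ℕ) : Function.Injective (letterCode (k := k)) := by
  rintro (a | ⟨m, a⟩) (b | ⟨n, b⟩) h
  · simp [letterCode] at h
    exact congrArg _ (Fin.ext h)
  · exfalso; change BVFun n at b; cases b <;> simp [letterCode, BVFun.code] at h
  · exfalso; change BVFun m at a; cases a <;> simp [letterCode, BVFun.code] at h
  · exact congrArg _ (BVFun.code_inj a b h)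

theorem candCode_injective (k : ℕ) : Function.Injective (candCode (k := k)) := fun _ _ h =>
  FirstOrder.Language.Term.listEncode_injective (List.map_injective_iff.2 (letterCode_injective k) h)

theorem specLetterCode_injective (k : ℕ) : Function.Injective (specLetterCode (k := k)) := by
  rintro (⟨⟨⟩⟩ | ⟨m, (a | a)⟩) (⟨⟨⟩⟩ | ⟨n, (b | b)⟩) h
  · have := BVFun.code_inj a b h
    cases this
    rfl
  · exfalso; change BVFun m at a; cases a <;> simp [specLetterCode, BVFun.code] at h
  · exfalso; change BVFun n at b; cases b <;> simp [specLetterCode, BVFun.code] at h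
  · cases a; cases b; rfl

theorem specCode_injective (k : ℕ) : Function.Injective (specCode (k := k)) := fun _ _ h =>
  FirstOrder.Language.Term.listEncode_injective (List.map_injective_iff.2 (specLetterCode_injective k) h)

theorem CFInstance.code_injective : Function.Injective CFInstance.code := by
  have hs (k : ℕ) : Function.Injective (symbolCode (k := k)) := by
    rintro (a | a) (b | b) h <;> simp [symbolCode] at h
    · exact congrArg _ (letterCode_injective k h)
    · exact congrArg _ h
  rintro ⟨k, φ, S, R⟩ ⟨k', φ', S', R'⟩ h
  simp only [CFInstance.code, Prod.mk.injEq] at h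
  obtain ⟨rfl, h2, rfl, h4⟩ := h
  obtain rfl := specCode_injective k h2
  congr 1
  refine List.map_injective_iff.2 ?_ h4
  rintro ⟨a, u⟩ ⟨b, v⟩ h
  simp only [Prod.mk.injEq] at h
  obtain ⟨rfl, h⟩ := h
  rw [List.map_injective_iff.2 (hs k) h]

theorem TreeRhs.code_injective (k : ℕ) : Function.Injective (TreeRhs.code (k := k)) := by
  rintro (a | @⟨m, a, ts⟩) (b | @⟨n, b, us⟩) h
  · simp [TreeRhs.code] at h
    exact congrArg _ (Fin.ext h)
  · exfalso; change BVFun n at b; cases b <;> simp [TreeRhs.code, BVFun.code] at h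
  · exfalso; change BVFun m at a; cases a <;> simp [TreeRhs.code, BVFun.code] at h
  · simp only [TreeRhs.code, Prod.mk.injEq] at h
    have := BVFun.code_inj a b h.1
    cases this
    congr 1
    funext i
    exact Sum.map_injective.2 ⟨Function.injective_id, candCode_injective k⟩
      (congrFun (List.ofFn_injective h.2) i)

theorem TreeInstance.code_injective : Function.Injective TreeInstance.code := by
  rintro ⟨k, φ, S, R⟩ ⟨k', φ', S', R'⟩ h
  simp only [TreeInstance.code, Prod.mk.injEq] at h
  obtain ⟨rfl, h2, rfl, h4⟩ := h
  obtain rfl := specCode_injective k h2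
  congr 1
  refine List.map_injective_iff.2 ?_ h4
  rintro ⟨a, u⟩ ⟨b, v⟩ h
  simp only [Prod.mk.injEq] at h
  obtain ⟨rfl, h⟩ := h
  rw [TreeRhs.code_injective k h]

end SyGuS

namespace SyGuS

open FirstOrder.Language (Term)

/-! ### Words as bit-vectors -/

/-! Candidates can spell out sequences of indices. If the grammar generates exactly the right-nested
concatenations `x_{i₁} ⋯ x_{iₘ}` along the paths of a finite automaton, then `f(U₁, …, U_k)`
evaluates to the word `U_{i₁} ⋯ U_{iₘ}`, and the specification `s ++ f(V₁, …, V_k) = f(U₁, …, U_k)`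
says that the path solves a Post correspondence problem with initial word `s`
(`Spec.valid_subst_correspondence`). Right-linear productions suffice for this, in both kinds of
grammar (`ControlledPCP.generates_iff`, `ControlledPCP.derives_iff`).

Such a problem expresses the halting of a queue machine. The word `s` followed by all appended words
is the complete history of the queue; the other side of the equation is the sequence of removed
letters. Equality means that each guessed letter really was at the front, and that the queue is
empty at the end. The automaton keeps track of the machine's state, and after halting it has edges
that empty the queue (`QueueMachine.reaches_of_path`, `QueueMachine.exists_path_of_reaches`).

A queue machine simulates the stack machines `TM2` (`StackQueue.respects`), into which partial
recursive functions compile by `tr_eval`. For one function with undecidable domain, the automaton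
and the words `Uᵢ`, `Vᵢ` are fixed, and only `s` depends on the input, in a primitive recursive way.
A decision procedure for the synthesis problem would therefore solve the halting problem. -/

theorem Val.ofBV_congr {w w' : ℕ} {x : BitVec w} {y : BitVec w'} (h : w = w')
    (hxy : ∀ i, x.getMsbD i = y.getMsbD i) : Val.ofBV x = Val.ofBV y := by
  subst h
  exact congrArg _ (BitVec.eq_of_getMsbD_eq fun i _ => hxy i)

/-- The bit-vector given by a list of bits, the most significant one first. -/
def wordVal (l : List Bool) : Val := .ofBV (BitVec.ofBoolListBE l)

theorem wordVal_singleton (b : Bool) : wordVal [b] = .ofBV (BitVec.ofBool b) :=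
  Val.ofBV_congr rfl fun i => by cases b <;> cases i <;> simp

/-- The width is part of a value, so leading zeros are not lost. -/
theorem wordVal_injective : Function.Injective wordVal := by
  intro l l' h
  have hlen : l.length = l'.length := by
    have := congrArg Sigma.fst h
    simpa [wordVal, Val.ofBV] using this
  -- The width is kept variable, so that substituting the length equation gives both bit-vectors the
  -- same type.
  have hbit : ∀ (w : ℕ) (x : BitVec w), w = l.length → Val.ofBV x = wordVal l →
      ∀ i, x.getMsbD i = l.getD i false := by
    rintro w x rfl hx i
    have : x = BitVec.ofBoolListBE l := by
      simpa [wordVal, Val.ofBV] using hx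
    rw [this, BitVec.getMsbD_ofBoolListBE]
  refine List.ext_getElem hlen fun i h₁ h₂ => ?_
  have := hbit _ (BitVec.ofBoolListBE l') hlen.symm h.symm i
  rw [BitVec.getMsbD_ofBoolListBE, List.getD_eq_getElem _ _ h₁, List.getD_eq_getElem _ _ h₂] at this
  exact this.symm

theorem concatOp_wordVal (l l' : List Bool) :
    concatOp (wordVal l) (wordVal l') = some (wordVal (l ++ l')) := by
  refine congrArg some (Val.ofBV_congr (by simp) fun i => ?_)
  erw [BitVec.getMsbD_append]
  simp only [BitVec.getMsbD_ofBoolListBE]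
  split_ifs with h
  · rw [List.getD_append_right _ _ _ _ h]
  · rw [List.getD_append _ _ _ _ (by omega)]

/-- An equation between different sorts is ill-sorted and thus not true, so no assumption on the
sorts is needed: words of different lengths simply fail the specification. -/
theorem eqOp_eq_true_iff (a b : Val) : eqOp a b = some (.ofBool true) ↔ a = b := by
  unfold eqOp
  constructor
  · split_ifs
    · simp [Val.ofBool]
    · simp
  · rintro rfl
    simp

/-! ### Terms for words -/

/-- The value of a term. -/
noncomputable abbrev termVal {α : Type} (ρ : Interp) (v : α → Option Val) (t : BV.Term α) :
    Option Val :=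
  @Term.realize BV (Option Val) (bvModel ρ) α v t

theorem termVal_func {α : Type} (ρ : Interp) (v : α → Option Val) {n : ℕ} (g : BVFun n)
    (ts : Fin n → BV.Term α) :
    termVal ρ v (.func g ts) = BVFun.eval ρ g fun i => termVal ρ v (ts i) :=
  rfl

theorem termVal_subst {α β : Type} (ρ : Interp) (v : β → Option Val) (t : BV.Term α)
    (ts : α → BV.Term β) :
    termVal ρ v (t.subst ts) = termVal ρ (fun a => termVal ρ v (ts a)) t :=
  letI := bvModel ρ
  FirstOrder.Language.Term.realize_subst

/-- The concatenation of two terms. -/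
def concatTerm {α : Type} (s t : BV.Term α) : BV.Term α := .func BVFun.concat ![s, t]

theorem termVal_concatTerm {α : Type} {ρ : Interp} {v : α → Option Val} {s t : BV.Term α}
    {l l' : List Bool} (hs : termVal ρ v s = some (wordVal l))
    (ht : termVal ρ v t = some (wordVal l')) :
    termVal ρ v (concatTerm s t) = some (wordVal (l ++ l')) := by
  rw [concatTerm, termVal_func]
  simp only [BVFun.eval, Matrix.cons_val_zero, Matrix.cons_val_one, hs, ht]
  exact concatOp_wordVal l l'

/-- The concatenation of the bound variables in a nonempty list. -/
def varChain {k : ℕ} : List (Fin k) → Cand k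
  -- A junk value: there is no empty bit-vector, and all paths are nonempty.
  | [] => .func BVFun.tt Fin.elim0
  | [i] => .var i
  | i :: j :: l => concatTerm (.var i) (varChain (j :: l))

theorem varChain_cons {k : ℕ} (i : Fin k) {l : List (Fin k)} (hl : l ≠ []) :
    varChain (i :: l) = concatTerm (.var i) (varChain l) := by
  cases l with
  | nil => exact absurd rfl hl
  | cons j l => rfl

theorem termVal_varChain {k : ℕ} {ρ : Interp} {v : Fin k → Option Val} {W : Fin k → List Bool}
    (hv : ∀ i, v i = some (wordVal (W i))) :
    ∀ {l : List (Fin k)}, l ≠ [] → termVal ρ v (varChain l) = some (wordVal (l.flatMap W))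
  | [i], _ => by simpa [varChain, termVal, FirstOrder.Language.Term.realize] using hv i
  | i :: j :: l, _ => by
    rw [List.flatMap_cons]
    exact termVal_concatTerm (hv i) (termVal_varChain hv (List.cons_ne_nil j l))

/-! ### Specifications that express a correspondence equation. -/

namespace Spec

variable {k : ℕ}

/-- The literal of width one with the given bit. -/
def bit (b : Bool) : Spec k := .func (Sum.inl (BVFun.lit 1 (BitVec.ofBool b))) Fin.elim0

/-- The concatenation of two terms. -/
def concat (s t : Spec k) : Spec k := .func (Sum.inl BVFun.concat) ![s, t]

/-- A term whose value is the given nonempty word. -/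
def word : List Bool → Spec k
  | [] => bit false
  | [b] => bit b
  | b :: c :: l => concat (bit b) (word (c :: l))

/-- The concatenation of a word and a term. -/
def append (l : List Bool) (t : Spec k) : Spec k := l.foldr (fun b s => concat (bit b) s) t

/-- The application of `f` to words. -/
def app (W : Fin k → List Bool) : Spec k := .func (Sum.inr FSym.f) fun i => word (W i)

/-- The equation `s ++ f(V₁, …, V_k) = f(U₁, …, U_k)`. -/
def correspondence (s : List Bool) (U V : Fin k → List Bool) : Spec k :=
  .func (Sum.inl BVFun.eq) ![append s (app V), app U]

theorem termVal_subst_bit (w : Cand k) (ρ : Interp) (b : Bool) :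
    termVal ρ Empty.elim (subst w (bit b)) = some (wordVal [b]) := by
  rw [wordVal_singleton]
  rfl

theorem subst_concat (w : Cand k) (s t : Spec k) :
    subst w (concat s t) = concatTerm (subst w s) (subst w t) := by
  simp only [concat, subst, concatTerm]
  congr 1
  funext i
  fin_cases i <;> rfl

theorem termVal_subst_word (w : Cand k) (ρ : Interp) :
    ∀ {l : List Bool}, l ≠ [] →
      termVal ρ Empty.elim (subst w (word l)) = some (wordVal l)
  | [b], _ => termVal_subst_bit w ρ b
  | b :: c :: l, _ => by
    rw [word, subst_concat]
    exact termVal_concatTerm (l := [b]) (termVal_subst_bit w ρ b)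
      (termVal_subst_word w ρ (List.cons_ne_nil c l))

theorem termVal_subst_append {w : Cand k} {ρ : Interp} {t : Spec k} {l' : List Bool}
    (ht : termVal ρ Empty.elim (subst w t) = some (wordVal l')) (l : List Bool) :
    termVal ρ Empty.elim (subst w (append l t)) = some (wordVal (l ++ l')) := by
  induction l with
  | nil => exact ht
  | cons b l ih =>
    rw [append, List.foldr_cons, subst_concat]
    exact termVal_concatTerm (l := [b]) (termVal_subst_bit w ρ b) ih

theorem termVal_subst_app {W : Fin k → List Bool} (hW : ∀ i, W i ≠ []) (ρ : Interp)
    {l : List (Fin k)} (hl : l ≠ []) :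
    termVal ρ Empty.elim (subst (varChain l) (app W)) = some (wordVal (l.flatMap W)) := by
  rw [app, subst, termVal_subst]
  exact termVal_varChain (fun i => termVal_subst_word _ ρ (hW i)) hl

theorem valid_subst_correspondence {s : List Bool} {U V : Fin k → List Bool}
    (hU : ∀ i, U i ≠ []) (hV : ∀ i, V i ≠ []) {l : List (Fin k)} (hl : l ≠ []) :
    Valid (subst (varChain l) (correspondence s U V)) ↔ s ++ l.flatMap V = l.flatMap U := by
  have key (ρ : Interp) : termVal ρ Empty.elim (subst (varChain l) (correspondence s U V)) =
      some (.ofBool true) ↔ s ++ l.flatMap V = l.flatMap U := by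
    rw [correspondence, subst, termVal_func]
    simp only [BVFun.eval, Matrix.cons_val_zero, Matrix.cons_val_one]
    rw [termVal_subst_append (termVal_subst_app hV ρ hl) s, termVal_subst_app hU ρ hl]
    simp only [Option.bind_some]
    rw [eqOp_eq_true_iff, wordVal_injective.eq_iff]
  -- No free constants occur, so any single interpretation decides validity.
  exact ⟨fun h => (key ⟨fun _ => false, fun _ _ => 0⟩).1 (h _), fun h ρ => (key ρ).2 h⟩

theorem specConcatEq_bit (b : Bool) : SpecConcatEq (bit b : Spec k) :=
  ⟨rfl, fun i => i.elim0⟩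

theorem specConcatEq_concat {s t : Spec k} (hs : SpecConcatEq s) (ht : SpecConcatEq t) :
    SpecConcatEq (concat s t) :=
  ⟨trivial, fun i => by fin_cases i <;> assumption⟩

theorem specConcatEq_word : ∀ l : List Bool, SpecConcatEq (word l : Spec k)
  | [] => specConcatEq_bit false
  | [b] => specConcatEq_bit b
  | b :: c :: l => specConcatEq_concat (specConcatEq_bit b) (specConcatEq_word (c :: l))

theorem specConcatEq_app (W : Fin k → List Bool) : SpecConcatEq (app W) :=
  ⟨trivial, fun i => specConcatEq_word (W i)⟩

theorem specConcatEq_append (l : List Bool) {t : Spec k} (ht : SpecConcatEq t) :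
    SpecConcatEq (append l t) := by
  induction l with
  | nil => exact ht
  | cons b l ih => exact specConcatEq_concat (specConcatEq_bit b) ih

theorem specConcatEq_correspondence (s : List Bool) (U V : Fin k → List Bool) :
    SpecConcatEq (correspondence s U V) :=
  ⟨trivial, fun i => by
    fin_cases i
    · exact specConcatEq_append s (specConcatEq_app V)
    · exact specConcatEq_app U⟩

/-- In prefix notation a right-nested concatenation is encoded letter by letter, so the code is
visibly primitive recursive in the prefix. -/
theorem specCode_append (l : List Bool) (t : Spec k) :
    specCode (append l t) = l.flatMap (fun b => [[16], [4, 1, b.toNat]]) ++ specCode t := by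
  induction l with
  | nil => rfl
  | cons b l ih =>
    rw [List.flatMap_cons, List.append_assoc, ← ih]
    cases b <;>
    simp [append, concat, bit, specCode, FirstOrder.Language.Term.listEncode, List.finRange_succ,
      specLetterCode, BVFun.code]

theorem specCode_correspondence (s : List Bool) (U V : Fin k → List Bool) :
    specCode (correspondence s U V) =
      [13] :: (s.flatMap (fun b => [[16], [4, 1, b.toNat]]) ++ specCode (app V)) ++
        specCode (app U) := by
  rw [← specCode_append]
  simp [correspondence, specCode, FirstOrder.Language.Term.listEncode, List.finRange_succ,
    specLetterCode, BVFun.code]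

end Spec

/-! ### Correspondence problems with a finite control -/

/-- A finite control whose edges are labelled by the indices of a correspondence problem. An edge
without a target ends a path. -/
abbrev Control (S T : Type) : Type := List (S × T × Option S)

/-- The nonempty sequences of indices on the paths from a state to the end. -/
inductive Control.Path {S T : Type} (E : Control S T) : S → List T → Prop
  | last {A : S} {i : T} (h : (A, i, none) ∈ E) : Path E A [i]
  | cons {A B : S} {i : T} {l : List T} (h : (A, i, some B) ∈ E) (hl : Path E B l) :
      Path E A (i :: l)

theorem Control.Path.ne_nil {S T : Type} {E : Control S T} {A : S} {l : List T}
    (h : E.Path A l) : l ≠ [] := by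
  cases h <;> simp

/-- Rename the states and the indices. -/
def Control.rename {S T S' T' : Type} (f : S → S') (g : T → T') (E : Control S T) :
    Control S' T' :=
  E.map (Prod.map f (Prod.map g (Option.map f)))

theorem Control.Path.rename {S T S' T' : Type} (f : S → S') (g : T → T') {E : Control S T}
    {A : S} {l : List T} (h : E.Path A l) : (E.rename f g).Path (f A) (l.map g) := by
  induction h with
  | last h => exact .last (List.mem_map.2 ⟨_, h, rfl⟩)
  | cons h _ ih => exact .cons (List.mem_map.2 ⟨_, h, rfl⟩) ih

/-- Injectivity on states ensures that consecutive renamed edges come from consecutive edges.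
Indices only label the edges and may be identified. -/
theorem Control.Path.of_rename {S T S' T' : Type} {f : S → S'} (hf : Function.Injective f)
    (g : T → T') {E : Control S T} {A : S} {l : List T'} (h : (E.rename f g).Path (f A) l) :
    ∃ l', E.Path A l' ∧ l = l'.map g := by
  generalize hA : f A = A' at h
  induction h generalizing A with
  | last h =>
    obtain ⟨⟨A₀, i, B | B⟩, hE, he⟩ := List.mem_map.1 h
    · simp only [Prod.map_apply, Option.map_none, Prod.mk.injEq] at he
      obtain rfl := hf (hA.trans he.1.symm)
      exact ⟨[i], .last hE, by simp [he.2.1]⟩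
    · simp at he
  | cons h _ ih =>
    obtain ⟨⟨A₀, i, B | B⟩, hE, he⟩ := List.mem_map.1 h
    · simp at he
    · simp only [Prod.map_apply, Option.map_some, Prod.mk.injEq, Option.some.injEq] at he
      obtain rfl := hf (hA.trans he.1.symm)
      obtain ⟨l, hl, rfl⟩ := ih he.2.2
      exact ⟨i :: l, .cons hE hl, by simp [he.2.1]⟩

/-- A correspondence problem with a finite control. -/
structure ControlledPCP where
  k : ℕ
  start : ℕ
  edges : Control ℕ (Fin k)
  top : Fin k → List Bool
  bot : Fin k → List Bool
  top_ne_nil : ∀ i, top i ≠ []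
  bot_ne_nil : ∀ i, bot i ≠ []

namespace ControlledPCP

variable (P : ControlledPCP)

/-- There is a path on which the two words coincide, if the bottom word is preceded by `s`. -/
def Solvable (s : List Bool) : Prop :=
  ∃ l, P.edges.Path P.start l ∧ s ++ l.flatMap P.bot = l.flatMap P.top

theorem solvable_iff (s : List Bool) {L : Set (Cand P.k)}
    (hL : ∀ w, w ∈ L ↔ ∃ l, P.edges.Path P.start l ∧ w = varChain l) :
    SyGuS.Solvable (Spec.correspondence s P.top P.bot) L ↔ P.Solvable s := by
  constructor
  · rintro ⟨w, hw, hv⟩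
    obtain ⟨l, hl, rfl⟩ := (hL w).1 hw
    exact ⟨l, hl, (Spec.valid_subst_correspondence P.top_ne_nil P.bot_ne_nil hl.ne_nil).1 hv⟩
  · rintro ⟨l, hl, h⟩
    exact ⟨_, (hL _).2 ⟨l, hl, rfl⟩,
      (Spec.valid_subst_correspondence P.top_ne_nil P.bot_ne_nil hl.ne_nil).2 h⟩

/-! ### Paths as derivations of a tree grammar. -/

/-- The tree production of an edge. -/
def treeRule {k : ℕ} : ℕ × Fin k × Option ℕ → ℕ × TreeRhs k
  | (A, i, none) => (A, .boundVar i)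
  | (A, i, some B) => (A, .app BVFun.concat ![Sum.inr (.var i), Sum.inl B])

/-- The instance with a tree grammar. -/
def treeInstance (s : List Bool) : TreeInstance :=
  ⟨P.k, Spec.correspondence s P.top P.bot, P.start, P.edges.map treeRule⟩

theorem generates_iff {k : ℕ} (E : Control ℕ (Fin k)) (A : ℕ) (w : Cand k) :
    Generates (E.map treeRule) A w ↔ ∃ l, E.Path A l ∧ w = varChain l := by
  constructor
  · intro h
    induction h with
    | @boundVar A i h =>
      obtain ⟨⟨A', i', B | B⟩, hE, he⟩ := List.mem_map.1 h
      · simp only [treeRule, Prod.mk.injEq, TreeRhs.boundVar.injEq] at he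
        obtain ⟨rfl, rfl⟩ := he
        exact ⟨_, .last hE, rfl⟩
      · simp [treeRule] at he
    | @app A n g ts us h hN hT ih =>
      obtain ⟨⟨A', i', B | B⟩, hE, he⟩ := List.mem_map.1 h
      · simp [treeRule] at he
      · simp only [treeRule, Prod.mk.injEq] at he
        obtain ⟨rfl, he⟩ := he
        cases he
        obtain ⟨l, hl, h₁⟩ := ih 1 B rfl
        have h₀ := hT 0 _ rfl
        refine ⟨_, .cons hE hl, ?_⟩
        rw [varChain_cons _ hl.ne_nil, ← h₁, ← h₀, concatTerm]
        congr 1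
        funext i
        fin_cases i <;> rfl
  · rintro ⟨l, hl, rfl⟩
    induction hl with
    | last h => exact .boundVar (List.mem_map.2 ⟨_, h, rfl⟩)
    | @cons A B i l h hl ih =>
      rw [varChain_cons _ hl.ne_nil]
      refine .app (g := BVFun.concat) (ts := ![Sum.inr (.var i), Sum.inl B]) _
        (List.mem_map.2 ⟨_, h, rfl⟩) ?_ ?_
      · intro j B' hj
        fin_cases j
        · simp at hj
        · cases hj
          exact ih
      · intro j t hj
        fin_cases j
        · cases hj
          rfl
        · simp at hj

theorem treeInstance_hasSolution (s : List Bool) :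
    (P.treeInstance s).HasSolution ↔ P.Solvable s :=
  P.solvable_iff s fun w => generates_iff P.edges P.start w

theorem treeInstance_concatEq (s : List Bool) : (P.treeInstance s).ConcatEq := by
  refine ⟨Spec.specConcatEq_correspondence _ _ _, fun r hr => ?_⟩
  obtain ⟨⟨A, i, B | B⟩, -, rfl⟩ := List.mem_map.1 hr
  · trivial
  · refine ⟨trivial, fun j t hj => ?_⟩
    fin_cases j
    · cases hj
      trivial
    · simp at hj

/-! ### Paths as derivations of a context-free grammar. -/

/-- The letter for concatenation. -/
def concatLetter {k : ℕ} : Letter k := Sum.inr ⟨2, BVFun.concat⟩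

/-- The context-free production of an edge. -/
def cfRule {k : ℕ} : ℕ × Fin k × Option ℕ → ContextFreeRule (Letter k) ℕ
  | (A, i, none) => ⟨A, [.terminal (Sum.inl i)]⟩
  | (A, i, some B) => ⟨A, [.terminal concatLetter, .terminal (Sum.inl i), .nonterminal B]⟩

/-- The instance with a context-free grammar. -/
def cfInstance (s : List Bool) : CFInstance :=
  ⟨P.k, Spec.correspondence s P.top P.bot, P.start, P.edges.map cfRule⟩

theorem listEncode_varChain_cons {k : ℕ} (i : Fin k) {l : List (Fin k)} (hl : l ≠ []) :
    (varChain (i :: l)).listEncode =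
      concatLetter :: Sum.inl i :: (varChain l).listEncode := by
  rw [varChain_cons i hl]
  simp [concatTerm, concatLetter, FirstOrder.Language.Term.listEncode, List.finRange_succ]

/-- In a right-linear grammar the only nonterminal stands at the end, so the place of the next
rewriting step is forced. -/
theorem terminal_append_nonterminal {T N : Type} {x : List T} {A B : N}
    {p q : List (Symbol T N)}
    (h : x.map Symbol.terminal ++ [.nonterminal A] = p ++ [.nonterminal B] ++ q) :
    p = x.map .terminal ∧ A = B ∧ q = [] := by
  induction x generalizing p with
  | nil =>
    cases p with
    | nil => simpa [eq_comm] using h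
    | cons a p => simp at h
  | cons c x ih =>
    cases p with
    | nil => simp at h
    | cons a p =>
      simp only [List.map_cons, List.cons_append, List.cons.injEq] at h
      obtain ⟨h₁, h₂, h₃⟩ := ih h.2
      exact ⟨by rw [List.map_cons, ← h.1, h₁], h₂, h₃⟩

theorem eq_of_derives_terminal {T : Type} {g : ContextFreeGrammar T} {x : List T}
    {u : List (Symbol T g.NT)} (h : g.Derives (x.map .terminal) u) : u = x.map .terminal := by
  rcases h.eq_or_head with h | ⟨v, ⟨r, -, hr⟩, -⟩
  · exact h.symm
  · simpa using hr.nonterminal_input_mem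

theorem derives_iff {k : ℕ} {E : Control ℕ (Fin k)} {R : Finset (ContextFreeRule (Letter k) ℕ)}
    (hR : ∀ r, r ∈ R ↔ ∃ e ∈ E, cfRule e = r) (S : ℕ) (y : List (Letter k)) :
    ContextFreeGrammar.Derives ⟨ℕ, S, R⟩ [.nonterminal S] (y.map .terminal) ↔
      ∃ l, E.Path S l ∧ y = (varChain l).listEncode := by
  constructor
  · intro h
    -- For the induction the start symbol is generalised to the sentential forms that occur before
    -- the last step: terminals followed by one nonterminal.
    suffices H : ∀ u : List (Symbol (Letter k) ℕ),
        ContextFreeGrammar.Derives ⟨ℕ, S, R⟩ u (y.map .terminal) →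
        ∀ (x : List (Letter k)) (A : ℕ), u = x.map .terminal ++ [.nonterminal A] →
        ∃ l, E.Path A l ∧ y = x ++ (varChain l).listEncode from
      H _ h [] _ rfl
    intro u hu
    induction hu using Relation.ReflTransGen.head_induction_on with
    | refl =>
      intro x A h
      have : Symbol.nonterminal A ∈ x.map Symbol.terminal ++ [.nonterminal A] := by simp
      rw [← h] at this
      simp at this
    | @head u v huv hv ih =>
      rintro x A rfl
      obtain ⟨r, hr, hrw⟩ := huv
      obtain ⟨p, q, hpq, rfl⟩ := hrw.exists_parts
      obtain ⟨rfl, hA, rfl⟩ := terminal_append_nonterminal hpq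
      obtain ⟨⟨A', i, B | B⟩, hE, rfl⟩ := (hR r).1 hr
      · obtain rfl : A = A' := hA
        refine ⟨[i], .last hE, ?_⟩
        have hx : x.map Symbol.terminal ++ (cfRule (A, i, none)).output ++ [] =
            (x ++ [Sum.inl i]).map Symbol.terminal := by
          rw [List.append_nil, List.map_append]
          rfl
        rw [hx] at hv
        exact List.map_injective_iff.2 (fun _ _ => Symbol.terminal.inj) (eq_of_derives_terminal hv)
      · obtain rfl : A = A' := hA
        obtain ⟨l, hl, rfl⟩ := ih (x ++ [concatLetter, Sum.inl i]) B (by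
          rw [List.append_nil, List.map_append, List.append_assoc]
          rfl)
        exact ⟨_, .cons hE hl, by simp [listEncode_varChain_cons i hl.ne_nil]⟩
  · rintro ⟨l, hl, rfl⟩
    suffices H : ∀ A, E.Path A l → ContextFreeGrammar.Derives ⟨ℕ, S, R⟩ [.nonterminal A]
        ((varChain l).listEncode.map .terminal) from H S hl
    clear hl
    intro A hl
    induction hl with
    | @last A i h =>
      exact ContextFreeGrammar.Produces.single
        ⟨_, (hR _).2 ⟨_, h, rfl⟩, ContextFreeRule.Rewrites.input_output⟩
    | @cons A B i l h hl ih =>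
      rw [listEncode_varChain_cons i hl.ne_nil]
      exact ContextFreeGrammar.Produces.trans_derives
        ⟨_, (hR _).2 ⟨_, h, rfl⟩, ContextFreeRule.Rewrites.input_output⟩
        (ih.append_left [.terminal concatLetter, .terminal (Sum.inl i)])

theorem mem_language_iff (s : List Bool) (y : List (Letter P.k)) :
    y ∈ (P.cfInstance s).grammar.language ↔
      ∃ l, P.edges.Path P.start l ∧ y = (varChain l).listEncode :=
  derives_iff (E := P.edges) (fun _ => (@List.mem_toFinset _ (_) _ _).trans List.mem_map) P.start y

theorem cfInstance_generatesTerms (s : List Bool) : (P.cfInstance s).GeneratesTerms := by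
  intro y hy
  obtain ⟨l, -, h⟩ := (P.mem_language_iff s y).1 hy
  exact ⟨_, h.symm⟩

theorem cfInstance_hasSolution (s : List Bool) :
    (P.cfInstance s).HasSolution ↔ P.Solvable s :=
  P.solvable_iff s fun _ => (P.mem_language_iff s _).trans
    (exists_congr fun _ => and_congr_right fun _ =>
      FirstOrder.Language.Term.listEncode_injective.eq_iff)

theorem cfInstance_concatEq (s : List Bool) : (P.cfInstance s).ConcatEq := by
  refine ⟨Spec.specConcatEq_correspondence _ _ _, fun r hr n g hg => ?_⟩
  obtain ⟨⟨A, i, B | B⟩, -, rfl⟩ := List.mem_map.1 hr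
  · cases hg with
    | tail _ h => cases h
  · cases hg with
    | head => trivial
    | tail _ h => cases h with
      | tail _ h => cases h with
        | tail _ h => cases h

/-! ### Undecidability from that of controlled correspondence problems -/

/-- The words of `P` are fixed, so everything but the prefix is a constant. -/
theorem primrec_specCode_correspondence {α : Type} [Primcodable α] {s : α → List Bool}
    (hs : Primrec s) :
    Primrec fun a => specCode (Spec.correspondence (s a) P.top P.bot) := by
  simp only [Spec.specCode_correspondence]
  refine Primrec.list_append.comp (Primrec.list_cons.comp (Primrec.const _)
    (Primrec.list_append.comp (Primrec.list_flatMap hs ?_) (Primrec.const _))) (Primrec.const _)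
  exact (Primrec.dom_finite fun b : Bool => [[16], [4, 1, b.toNat]]).comp₂ Primrec₂.right

/-- The supposed procedure need only halt on the class `C`; since the reduction stays inside it, the
composition is total and decides `p`. -/
theorem undecidable_of_reduction {ι γ : Type} [Primcodable γ] {code : ι → γ} {C Q : ι → Prop}
    {p : ℕ → Prop} (hp : ¬ ComputablePred p) (f : ℕ → ι) (hf : Computable fun n => code (f n))
    (hC : ∀ n, C (f n)) (hQ : ∀ n, Q (f n) ↔ p n) : Undecidable code C Q := by
  classical
  rintro ⟨d, hd, h⟩
  refine hp (ComputablePred.computable_iff.2 ⟨fun n => decide (p n), ?_, by simp⟩)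
  refine (hd.comp hf).of_eq fun n => ?_
  obtain ⟨b, hb, hbQ⟩ := h (f n) (hC n)
  have : b = decide (p n) := by
    rw [Bool.eq_iff_iff, hbQ, hQ, decide_eq_true_iff]
  rw [Part.eq_some_iff.2 hb, this]
  rfl

theorem undecidable_cfInstance {s : ℕ → List Bool} (hs : Primrec s)
    (h : ¬ ComputablePred fun n => P.Solvable (s n)) :
    Undecidable CFInstance.code (fun I => I.GeneratesTerms ∧ I.ConcatEq)
      CFInstance.HasSolution :=
  undecidable_of_reduction h (fun n => P.cfInstance (s n))
    (Primrec.pair (Primrec.const P.k) (Primrec.pair (P.primrec_specCode_correspondence hs)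
      -- The start symbol and the productions do not depend on the prefix, so their code can be
      -- taken from the instance with the empty one.
      (Primrec.const (P.cfInstance []).code.2.2))).to_comp
    (fun _ => ⟨P.cfInstance_generatesTerms _, P.cfInstance_concatEq _⟩)
    fun _ => P.cfInstance_hasSolution _

theorem undecidable_treeInstance {s : ℕ → List Bool} (hs : Primrec s)
    (h : ¬ ComputablePred fun n => P.Solvable (s n)) :
    Undecidable TreeInstance.code (fun I => I.ConcatEq) TreeInstance.HasSolution :=
  undecidable_of_reduction h (fun n => P.treeInstance (s n))
    (Primrec.pair (Primrec.const P.k) (Primrec.pair (P.primrec_specCode_correspondence hs)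
      (Primrec.const (P.treeInstance []).code.2.2))).to_comp
    (fun _ => P.treeInstance_concatEq _) fun _ => P.treeInstance_hasSolution _

end ControlledPCP

/-! ### Larger classes of instances, and the coding of finite alphabets by bits. -/

theorem Undecidable.mono {ι γ : Type} [Primcodable γ] {code : ι → γ} {C C' Q : ι → Prop}
    (h : Undecidable code C Q) (hC : ∀ I, C I → C' I) : Undecidable code C' Q :=
  fun ⟨d, hd, H⟩ => h ⟨d, hd, fun I hI => H I (hC I hI)⟩

/-- A block code of constant positive length is uniquely decodable. -/
theorem flatMap_injective {α β : Type} {f : α → List β} (hf : Function.Injective f) {m : ℕ}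
    (hm : 0 < m) (hlen : ∀ a, (f a).length = m) :
    Function.Injective fun l : List α => l.flatMap f := by
  intro l
  induction l with
  | nil =>
    rintro (_ | ⟨b, l'⟩) h
    · rfl
    · have := congrArg List.length h
      simp [hlen] at this
      omega
  | cons a l ih =>
    rintro (_ | ⟨b, l'⟩) h
    · have := congrArg List.length h
      simp [hlen] at this
      omega
    · simp only [List.flatMap_cons] at h
      obtain ⟨h₁, h₂⟩ := List.append_inj h (by rw [hlen, hlen])
      rw [hf h₁, ih h₂]

/-- The code of an element of a finite type by as many bits as there are elements, one of which is
set. -/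
noncomputable def oneHot {A : Type} [Fintype A] (a : A) : List Bool :=
  List.ofFn fun i => decide (i = Fintype.equivFin A a)

theorem oneHot_injective {A : Type} [Fintype A] : Function.Injective (oneHot (A := A)) := by
  intro a b h
  have := congrFun (List.ofFn_injective h) (Fintype.equivFin A a)
  simpa using this

theorem length_oneHot {A : Type} [Fintype A] (a : A) :
    (oneHot a).length = Fintype.card A := by
  simp [oneHot]

theorem flatMap_oneHot_injective {A : Type} [Fintype A] [Nonempty A] :
    Function.Injective fun l : List A => l.flatMap oneHot :=
  flatMap_injective oneHot_injective Fintype.card_pos length_oneHot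

theorem flatMap_oneHot_ne_nil {A : Type} [Fintype A] [Nonempty A] {l : List A} (hl : l ≠ []) :
    l.flatMap oneHot ≠ [] :=
  fun h => hl (flatMap_oneHot_injective h)

/-- The correspondence problem given by words over a finite alphabet. -/
noncomputable def ControlledPCP.ofFintype {S T A : Type} [Countable S] [Fintype T] [Fintype A]
    [Nonempty A] (start : S) (E : Control S T) (top bot : T → List A)
    (htop : ∀ i, top i ≠ []) (hbot : ∀ i, bot i ≠ []) : ControlledPCP where
  k := Fintype.card T
  start := (exists_injective_nat S).choose start
  edges := E.rename (exists_injective_nat S).choose (Fintype.equivFin T)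
  top i := (top ((Fintype.equivFin T).symm i)).flatMap oneHot
  bot i := (bot ((Fintype.equivFin T).symm i)).flatMap oneHot
  top_ne_nil _ := flatMap_oneHot_ne_nil (htop _)
  bot_ne_nil _ := flatMap_oneHot_ne_nil (hbot _)

theorem ControlledPCP.solvable_ofFintype {S T A : Type} [Countable S] [Fintype T] [Fintype A]
    [Nonempty A] (start : S) (E : Control S T) (top bot : T → List A)
    (htop : ∀ i, top i ≠ []) (hbot : ∀ i, bot i ≠ []) (s : List A) :
    (ofFintype start E top bot htop hbot).Solvable (s.flatMap oneHot) ↔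
      ∃ l, E.Path start l ∧ s ++ l.flatMap bot = l.flatMap top := by
  have key (W : T → List A) (l : List T) :
      (l.map (Fintype.equivFin T)).flatMap
        (fun i => (W ((Fintype.equivFin T).symm i)).flatMap oneHot) =
      (l.flatMap W).flatMap oneHot := by
    simp [List.flatMap_map, List.flatMap_assoc]
  have heq (l : List T) : s.flatMap oneHot ++ (l.flatMap bot).flatMap oneHot =
      (l.flatMap top).flatMap oneHot ↔ s ++ l.flatMap bot = l.flatMap top := by
    rw [← List.flatMap_append]
    exact flatMap_oneHot_injective.eq_iff
  constructor
  · rintro ⟨l, hl, h⟩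
    obtain ⟨l, hl', rfl⟩ := hl.of_rename (exists_injective_nat S).choose_spec
    exact ⟨l, hl', (heq l).1 (by rw [← key, ← key]; exact h)⟩
  · rintro ⟨l, hl, h⟩
    refine ⟨_, hl.rename _ _, ?_⟩
    have := (heq l).2 h
    rw [← key, ← key] at this
    exact this

/-! ### Queue machines -/

/-- A deterministic automaton with a queue. In each step it removes the first letter of the queue and
appends a nonempty word at the end. It halts when there is no next state. -/
structure QueueMachine (Q A : Type) where
  next : Q → A → Option Q
  out : Q → A → List A
  out_ne_nil : ∀ q a, out q a ≠ []

namespace QueueMachine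

variable {Q A : Type} (M : QueueMachine Q A)

/-- One step of the machine. -/
def step : Option Q × List A → Option (Option Q × List A)
  | (some q, a :: s) => some (M.next q a, s ++ M.out q a)
  | _ => none

/-- `step` also stops on an empty queue, but this never happens: each step removes one letter and
appends at least one. -/
theorem eval_dom_iff {c : Option Q} {s : List A} (hs : s ≠ []) :
    (StateTransition.eval M.step (c, s)).Dom ↔
      ∃ t, StateTransition.Reaches M.step (c, s) (none, t) := by
  rw [Part.dom_iff_mem]
  simp only [StateTransition.mem_eval]
  constructor
  · rintro ⟨⟨c', t⟩, hr, ht⟩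
    suffices h : t ≠ [] by
      obtain _ | q := c'
      · exact ⟨t, hr⟩
      · obtain _ | ⟨a, t⟩ := t
        · exact absurd rfl h
        · simp [step] at ht
    clear ht
    generalize hd : (c', t) = d at hr
    induction hr generalizing c' t with
    | refl =>
      cases hd
      exact hs
    | @tail d e _ hde _ =>
      subst hd
      obtain ⟨_ | q, _ | ⟨a, u⟩⟩ := d <;> simp [step] at hde
      simp [← hde.2, M.out_ne_nil]
  · rintro ⟨t, ht⟩
    exact ⟨_, ht, rfl⟩

/-- The letters that are removed. -/
def top : Q × A ⊕ A × A → List A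
  | Sum.inl p => [p.2]
  | Sum.inr p => [p.1, p.2]

/-- The letters that are appended. -/
def bot : Q × A ⊕ A × A → List A
  | Sum.inl p => M.out p.1 p.2
  | Sum.inr p => [p.2]

theorem top_ne_nil (i : Q × A ⊕ A × A) : top i ≠ [] := by
  cases i <;> simp [top]

theorem bot_ne_nil (i : Q × A ⊕ A × A) : M.bot i ≠ [] := by
  cases i <;> simp [bot, M.out_ne_nil]

variable [Fintype Q] [Fintype A]

/-- The finite control simulating the machine; when the machine has halted, the queue is emptied. -/
noncomputable def control : Control (Option Q) (Q × A ⊕ A × A) :=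
  (Finset.univ : Finset (Q × A)).toList.map
      (fun p => (some p.1, Sum.inl p, some (M.next p.1 p.2))) ++
    ((Finset.univ : Finset (A × A)).toList.map (fun p => (none, Sum.inr p, some none)) ++
    (Finset.univ : Finset A).toList.map (fun a => (none, Sum.inr (a, a), none)))

theorem mem_control_some {q : Q} {i : Q × A ⊕ A × A} {B : Option (Option Q)} :
    (some q, i, B) ∈ M.control ↔ ∃ a, i = Sum.inl (q, a) ∧ B = some (M.next q a) := by
  simp only [control, List.mem_append, List.mem_map, Finset.mem_toList, Finset.mem_univ, true_and,
    Prod.exists, Prod.mk.injEq, reduceCtorEq, false_and, exists_false, or_false,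
    Option.some.injEq]
  constructor
  · rintro ⟨q', a, rfl, rfl, rfl⟩
    exact ⟨a, rfl, rfl⟩
  · rintro ⟨a, rfl, rfl⟩
    exact ⟨q, a, rfl, rfl, rfl⟩

/-- The path guesses the letters to be removed, and the equation checks the guesses. A path can end
only in the halted state, so a solution contains a halting run. -/
theorem reaches_of_path {c : Option Q} {l : List (Q × A ⊕ A × A)} (hl : M.control.Path c l) :
    ∀ {s : List A}, s ≠ [] → s ++ l.flatMap M.bot = l.flatMap top →
      ∃ t, StateTransition.Reaches M.step (c, s) (none, t) := by
  induction hl with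
  | @last c i h =>
    intro s hs _
    cases c with
    | none => exact ⟨s, .refl⟩
    | some q => simp [mem_control_some] at h
  | @cons c B i l h hl ih =>
    intro s hs hsl
    cases c with
    | none => exact ⟨s, .refl⟩
    | some q =>
      obtain ⟨a, rfl, hB⟩ := M.mem_control_some.1 h
      obtain rfl := Option.some.inj hB
      obtain _ | ⟨b, s⟩ := s
      · exact absurd rfl hs
      -- Comparing first letters shows that the guess is the front of the queue; the rest is the
      -- same equation for the next queue.
      · simp only [List.flatMap_cons, top, bot, List.cons_append, List.nil_append,
          List.cons.injEq] at hsl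
        obtain ⟨rfl, hsl⟩ := hsl
        obtain ⟨t, ht⟩ := ih (s := s ++ M.out q b) (by simp [M.out_ne_nil])
          (by rw [List.append_assoc, hsl])
        exact ⟨t, .head rfl ht⟩

theorem exists_path_none (n : ℕ) : ∀ s : List A, s.length = n + 1 →
    ∃ l, M.control.Path none l ∧ s ++ l.flatMap M.bot = l.flatMap top := by
  induction n with
  | zero =>
    intro s hs
    obtain ⟨a, rfl⟩ := List.length_eq_one_iff.1 hs
    -- As no word may be empty, the last index appends `a` once more and removes both copies.
    exact ⟨[Sum.inr (a, a)], .last (by simp [control]), by simp [top, bot]⟩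
  | succ n ih =>
    rintro (_ | ⟨a, _ | ⟨b, s⟩⟩) hs
    · simp at hs
    · simp at hs
    · obtain ⟨l, hl, h⟩ := ih (s ++ [b]) (by simpa using hs)
      -- This index removes `a` and `b` and appends `b`, which shortens the queue by one.
      refine ⟨Sum.inr (a, b) :: l, .cons (by simp [control]) hl, ?_⟩
      simp [top, bot, ← h]

theorem exists_path_of_reaches {c : Option Q} {s t : List A} (hs : s ≠ [])
    (h : StateTransition.Reaches M.step (c, s) (none, t)) :
    ∃ l, M.control.Path c l ∧ s ++ l.flatMap M.bot = l.flatMap top := by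
  have hnone (u : List A) (hu : u ≠ []) := M.exists_path_none (u.length - 1) u
    (by have := List.length_pos_iff.2 hu; omega)
  generalize hd : (c, s) = d at h
  induction h using Relation.ReflTransGen.head_induction_on generalizing c s with
  | refl =>
    cases hd
    exact hnone _ hs
  | @head d e hde _ ih =>
    subst hd
    obtain _ | q := c
    · simp [step] at hde
    · obtain _ | ⟨a, s⟩ := s
      · simp [step] at hde
      · simp only [step, Option.mem_def, Option.some.injEq] at hde
        obtain ⟨l, hl, h⟩ := ih (by simp [M.out_ne_nil]) hde
        exact ⟨_, .cons (M.mem_control_some.2 ⟨a, rfl, rfl⟩) hl, by simp [top, bot, ← h]⟩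

/-- The correspondence problem of the machine. -/
noncomputable def toControlledPCP [Nonempty A] (q : Q) : ControlledPCP :=
  .ofFintype (some q) M.control top M.bot top_ne_nil M.bot_ne_nil

theorem solvable_toControlledPCP [Nonempty A] (q : Q) {s : List A} (hs : s ≠ []) :
    (M.toControlledPCP q).Solvable (s.flatMap oneHot) ↔
      (StateTransition.eval M.step (some q, s)).Dom := by
  rw [toControlledPCP, ControlledPCP.solvable_ofFintype, eval_dom_iff _ hs]
  exact ⟨fun ⟨_, hl, h⟩ => M.reaches_of_path hl hs h, fun ⟨_, h⟩ => M.exists_path_of_reaches hs h⟩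

end QueueMachine

open Turing StateTransition

/-- The restriction of a machine to a closed set of states. -/
def QueueMachine.restrict {Q A : Type} (M : QueueMachine Q A) (p : Q → Prop)
    (hp : ∀ q a q', p q → M.next q a = some q' → p q') : QueueMachine {q // p q} A where
  next q a := (M.next q a).pmap Subtype.mk fun q' h => hp q a q' q.2 h
  out q a := M.out q a
  out_ne_nil q a := M.out_ne_nil q a

/-- Used to pass to a finite set of states: the states of the simulating machine contain arbitrary
statements, of which there may be infinitely many. -/
theorem QueueMachine.eval_restrict_dom {Q A : Type} (M : QueueMachine Q A) (p : Q → Prop)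
    (hp : ∀ q a q', p q → M.next q a = some q' → p q') (q : Q) (hq : p q) (s : List A) :
    (eval (M.restrict p hp).step (some ⟨q, hq⟩, s)).Dom ↔ (eval M.step (some q, s)).Dom := by
  have H : Respects M.step (M.restrict p hp).step
      fun c d => c = (d.1.map Subtype.val, d.2) := by
    rintro c ⟨_ | q, _ | ⟨a, s⟩⟩ rfl
    · rfl
    · rfl
    · rfl
    · exact ⟨_, by simp [restrict, Option.map_pmap], .single rfl⟩
  exact tr_eval_dom H rfl

/-! ### Simulation of stack machines by queue machines

The queue contains a mark (`none`), and the entries of all stacks, in the order in which they appear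
in each stack from the top to the bottom, interspersed with blanks (`some none`). -/

namespace StackQueue

theorem some_mem_stmts {K Γ Λ σ : Type} (M : Λ → TM2.Stmt (fun _ : K => Γ) Λ σ) {S : Finset Λ}
    {l : Λ} (hl : l ∈ S) : some (M l) ∈ TM2.stmts M S := by
  simp only [TM2.stmts, Finset.some_mem_insertNone, Finset.mem_biUnion]
  exact ⟨l, hl, TM2.stmts₁_self⟩

variable {K Γ Λ σ : Type} [DecidableEq K]

/-- A letter of the queue that is not the mark: a blank or an entry of a stack. -/
abbrev Cell (K Γ : Type) : Type := Option (K × Γ)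

/-- The symbol of a cell, if it belongs to the stack `k`. -/
def proj (k : K) (y : Cell K Γ) : Option Γ := y.bind fun p => if p.1 = k then some p.2 else none

/-- A state: whether the machine is looking for the top of a stack, the statement to be executed,
and the internal state. -/
abbrev State (K Γ Λ σ : Type) : Type := Bool × TM2.Stmt (fun _ : K => Γ) Λ σ × σ

/-- The next state. -/
def next (M : Λ → TM2.Stmt (fun _ : K => Γ) Λ σ) :
    State K Γ Λ σ → Option (Cell K Γ) → Option (State K Γ Λ σ)
  | (false, .push _ _ q, v), none => some (false, q, v)
  | (false, .load a q, v), none => some (false, q, a v)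
  | (false, .branch f q₁ q₂, v), none => some (false, bif f v then q₁ else q₂, v)
  | (false, .goto l, v), none => some (false, M (l v), v)
  | (false, .halt, _), none => none
  | (false, q, v), none => some (true, q, v)
  | (true, .peek _ f q, v), none => some (false, q, f v none)
  | (true, .pop _ f q, v), none => some (false, q, f v none)
  | (true, .peek k f q, v), some y =>
    match proj k y with
    | none => some (true, .peek k f q, v)
    | some a => some (false, q, f v (some a))
  | (true, .pop k f q, v), some y =>
    match proj k y with
    | none => some (true, .pop k f q, v)
    | some a => some (false, q, f v (some a))
  -- Cells pass by unchanged while the mark is awaited. A search with any statement other than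
  -- `peek` and `pop` is never entered from a non-searching state.
  | p, _ => some p

/-- The letters appended to the queue. -/
def out : State K Γ Λ σ → Option (Cell K Γ) → List (Option (Cell K Γ))
  | (false, .push k f _, v), none => [none, some (some (k, f v))]
  | (true, .pop k _ _, _), some y =>
    match proj k y with
    | none => [some y]
    | some _ => [some none]
  | _, x => [x]

theorem out_ne_nil (p : State K Γ Λ σ) (x : Option (Cell K Γ)) : out p x ≠ [] := by
  unfold out
  split <;> try split
  all_goals simp

/-- The queue machine simulating a stack machine. -/
def machine (M : Λ → TM2.Stmt (fun _ : K => Γ) Λ σ) :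
    QueueMachine (State K Γ Λ σ) (Option (Cell K Γ)) :=
  ⟨next M, out, out_ne_nil⟩

variable (M : Λ → TM2.Stmt (fun _ : K => Γ) Λ σ)

theorem step_eq (p : State K Γ Λ σ) (x : Option (Cell K Γ)) (s : List (Option (Cell K Γ))) :
    (machine M).step (some p, x :: s) = some (next M p x, s ++ out p x) :=
  rfl

theorem reaches_trans {c d e : Option (State K Γ Λ σ) × List (Option (Cell K Γ))}
    (h₁ : Reaches (machine M).step c d) (h₂ : Reaches (machine M).step d e) :
    Reaches (machine M).step c e :=
  .trans h₁ h₂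

theorem reaches_head {p : State K Γ Λ σ} {x : Option (Cell K Γ)} {s : List (Option (Cell K Γ))}
    {d : Option (State K Γ Λ σ) × List (Option (Cell K Γ))}
    (h : Reaches (machine M).step (next M p x, s ++ out p x) d) :
    Reaches (machine M).step (some p, x :: s) d :=
  .head (step_eq M p x s) h

/-- Letters that neither change the state nor get changed move from the front to the end: the queue
rotates. -/
theorem reaches_of_stay {p : State K Γ Λ σ} :
    ∀ {u : List (Cell K Γ)} (s : List (Option (Cell K Γ))),
    (∀ y ∈ u, next M p (some y) = some p ∧ out p (some y) = [some y]) →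
      Reaches (machine M).step (some p, u.map some ++ s) (some p, s ++ u.map some)
  | [], s, _ => by
    rw [List.map_nil, List.append_nil, List.nil_append]
    exact .refl
  | y :: u, s, h => by
    refine reaches_head M (s := u.map some ++ s) ?_
    obtain ⟨h₁, h₂⟩ := h y (by simp)
    rw [h₁, h₂]
    simpa using reaches_of_stay (s ++ [some y]) fun y hy => h y (by simp [hy])

theorem reaches_rotate (q : TM2.Stmt (fun _ : K => Γ) Λ σ) (v : σ) (u w : List (Cell K Γ)) :
    Reaches (machine M).step (some (false, q, v), u.map some ++ none :: w.map some)
      (some (false, q, v), none :: (w ++ u).map some) := by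
  simpa using reaches_of_stay M (p := (false, q, v)) (u := u) (none :: w.map some)
    fun y _ => by cases q <;> exact ⟨rfl, rfl⟩

/-- The cells contain the entries of the stacks. -/
def Encodes (S : K → List Γ) (u : List (Cell K Γ)) : Prop := ∀ k, u.filterMap (proj k) = S k

/-- The first entry of a stack. -/
theorem exists_first (k : K) (u : List (Cell K Γ)) :
    (u.filterMap (proj k) = [] ∧ ∀ y ∈ u, proj k y = none) ∨
    ∃ u₁ a u₂, u = u₁ ++ some (k, a) :: u₂ ∧ ∀ y ∈ u₁, proj k y = none := by
  induction u with
  | nil => simp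
  | cons y u ih =>
    cases hy : proj k y with
    | none =>
      rcases ih with ⟨h₁, h₂⟩ | ⟨u₁, a, u₂, rfl, h⟩
      · exact .inl ⟨by simpa [hy] using h₁, by simpa [hy] using h₂⟩
      · exact .inr ⟨y :: u₁, a, u₂, rfl, by simpa [hy] using h⟩
    | some a =>
      refine .inr ⟨[], a, u, ?_, by simp⟩
      obtain _ | ⟨k', b⟩ := y
      · simp [proj] at hy
      · simp only [proj, Option.bind_some, Option.ite_none_right_eq_some, Option.some.injEq] at hy
        simp [hy.1, hy.2]

theorem filterMap_proj_eq_nil {k : K} {u : List (Cell K Γ)} (h : ∀ y ∈ u, proj k y = none) :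
    u.filterMap (proj k) = [] :=
  List.filterMap_eq_nil_iff.2 h

theorem proj_self (k : K) (a : Γ) : proj k (some (k, a)) = some a := by simp [proj]

theorem filterMap_proj_blank (k : K) (u : List (Cell K Γ)) :
    List.filterMap (proj k) (none :: u) = u.filterMap (proj k) := rfl

theorem proj_of_ne {k k' : K} (h : k' ≠ k) (a : Γ) : proj k' (some (k, a)) = none := by
  simp [proj, h.symm]

theorem encodes_push {S : K → List Γ} {u : List (Cell K Γ)} (h : Encodes S u) (k : K) (a : Γ) :
    Encodes (Function.update S k (a :: S k)) (some (k, a) :: u) := by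
  intro k'
  by_cases hk : k' = k
  · subst hk
    simp [proj_self, h k']
  · simp [hk, proj_of_ne hk, h k']

theorem reaches_peek (k : K) (f : σ → Option Γ → σ) (q : TM2.Stmt (fun _ : K => Γ) Λ σ) (v : σ)
    {S : K → List Γ} {u : List (Cell K Γ)} (hu : Encodes S u) :
    ∃ u', Encodes S u' ∧ Reaches (machine M).step
      (some (false, .peek k f q, v), none :: u.map some)
      (some (false, q, f v (S k).head?), none :: u'.map some) := by
  have hstay {u' : List (Cell K Γ)} (hu' : ∀ y ∈ u', proj k y = none) :
      ∀ y ∈ u', next M (true, .peek k f q, v) (some y) = some (true, .peek k f q, v) ∧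
        out (true, .peek k f q, v) (some y) = [some y] :=
    fun y hy => ⟨by simp [next, hu' y hy], rfl⟩
  rcases exists_first k u with ⟨hk, hnone⟩ | ⟨u₁, a, u₂, rfl, hnone⟩
  · refine ⟨u, hu, .head (step_eq M _ _ _) (.trans (reaches_of_stay M _ (hstay hnone)) ?_)⟩
    rw [← hu k, hk]
    -- The mark has returned to the front without an entry being found, which shows that the stack
    -- is empty.
    refine .head (step_eq M _ _ _) ?_
    exact reaches_rotate M q (f v none) u []
  · have hS : (S k).head? = some a := by
      rw [← hu k]
      simp [filterMap_proj_eq_nil hnone, proj_self]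
    refine ⟨u₁ ++ some (k, a) :: u₂, hu, reaches_head M ?_⟩
    have h₁ := reaches_of_stay M (some (some (k, a)) :: u₂.map some ++ [none]) (hstay hnone)
    have h₂ := reaches_rotate M q (f v (some a)) u₂ (u₁ ++ [some (k, a)])
    rw [hS]
    refine reaches_trans M (by simpa [next, out] using h₁) (reaches_head M ?_)
    simpa [next, out, proj_self] using h₂

theorem reaches_pop (k : K) (f : σ → Option Γ → σ) (q : TM2.Stmt (fun _ : K => Γ) Λ σ) (v : σ)
    {S : K → List Γ} {u : List (Cell K Γ)} (hu : Encodes S u) :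
    ∃ u', Encodes (Function.update S k (S k).tail) u' ∧ Reaches (machine M).step
      (some (false, .pop k f q, v), none :: u.map some)
      (some (false, q, f v (S k).head?), none :: u'.map some) := by
  have hstay {u' : List (Cell K Γ)} (hu' : ∀ y ∈ u', proj k y = none) :
      ∀ y ∈ u', next M (true, .pop k f q, v) (some y) = some (true, .pop k f q, v) ∧
        out (true, .pop k f q, v) (some y) = [some y] :=
    fun y hy => ⟨by simp [next, hu' y hy], by simp [out, hu' y hy]⟩
  rcases exists_first k u with ⟨hk, hnone⟩ | ⟨u₁, a, u₂, rfl, hnone⟩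
  · refine ⟨u, ?_, .head (step_eq M _ _ _) (.trans (reaches_of_stay M _ (hstay hnone)) ?_)⟩
    · have : (S k).tail = S k := by rw [← hu k, hk]; rfl
      rwa [this, Function.update_eq_self]
    rw [← hu k, hk]
    refine .head (step_eq M _ _ _) ?_
    exact reaches_rotate M q (f v none) u []
  · have hS : S k = a :: u₂.filterMap (proj k) := by
      rw [← hu k]
      simp [filterMap_proj_eq_nil hnone, proj_self]
    -- The popped entry becomes a blank, since every step has to append something; `proj` ignores
    -- blanks.
    refine ⟨u₁ ++ none :: u₂, fun k' => ?_, reaches_head M ?_⟩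
    · by_cases hk : k' = k
      · subst hk
        simp [hS, filterMap_proj_eq_nil hnone, filterMap_proj_blank]
      · simp [hk, ← hu k', proj_of_ne hk, filterMap_proj_blank]
    have h₁ := reaches_of_stay M (some (some (k, a)) :: u₂.map some ++ [none]) (hstay hnone)
    have h₂ := reaches_rotate M q (f v (some a)) u₂ (u₁ ++ [none])
    rw [hS]
    refine reaches_trans M (by simpa [next, out] using h₁) (reaches_head M ?_)
    simpa [next, out, proj_self] using h₂

/-- The configurations of the queue machine that represent one of the stack machine. -/
def Represents (c : TM2.Cfg (fun _ : K => Γ) Λ σ)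
    (d : Option (State K Γ Λ σ) × List (Option (Cell K Γ))) : Prop :=
  match c.l with
  | none => d.1 = none
  | some l => ∃ u, Encodes c.stk u ∧ d = (some (false, M l, c.var), none :: u.map some)

/-- Each elementary statement is executed when the mark is in front, and a rotation then brings the
mark back. At least one step is made, as `Respects` demands. -/
theorem represents_stepAux (q : TM2.Stmt (fun _ : K => Γ) Λ σ) (v : σ) (S : K → List Γ)
    (u : List (Cell K Γ)) (hu : Encodes S u) :
    ∃ d, Represents M (TM2.stepAux q v S) d ∧
      Reaches₁ (machine M).step (some (false, q, v), none :: u.map some) d := by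
  induction q generalizing v S u with
  | push k f q ih =>
    obtain ⟨d, hd, h⟩ := ih v _ _ (encodes_push hu k (f v))
    -- The mark and the new entry go to the end together; once the old cells have rotated past, the
    -- entry directly follows the mark and so is on top.
    refine ⟨d, hd, .head (step_eq M _ _ _) (.trans_right ?_ h)⟩
    exact reaches_rotate M q v u [some (k, f v)]
  | peek k f q ih =>
    obtain ⟨u', hu', h'⟩ := reaches_peek M k f q v hu
    obtain ⟨d, hd, h⟩ := ih _ _ _ hu'
    exact ⟨d, hd, .trans_right h' h⟩
  | pop k f q ih =>
    obtain ⟨u', hu', h'⟩ := reaches_pop M k f q v hu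
    obtain ⟨d, hd, h⟩ := ih _ _ _ hu'
    exact ⟨d, hd, .trans_right h' h⟩
  | load a q ih =>
    obtain ⟨d, hd, h⟩ := ih (a v) _ _ hu
    exact ⟨d, hd, .head (step_eq M _ _ _) (.trans_right (reaches_rotate M q (a v) u []) h)⟩
  | branch f q₁ q₂ ih₁ ih₂ =>
    obtain ⟨d, hd, h⟩ : ∃ d, Represents M (TM2.stepAux (bif f v then q₁ else q₂) v S) d ∧
        Reaches₁ (machine M).step (some (false, bif f v then q₁ else q₂, v), none :: u.map some) d := by
      cases f v
      · exact ih₂ v S u hu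
      · exact ih₁ v S u hu
    refine ⟨d, ?_, .head (step_eq M _ _ _) (.trans_right (reaches_rotate M _ v u []) h)⟩
    rw [TM2.stepAux]
    cases hf : f v <;> simpa [hf] using hd
  | goto l =>
    exact ⟨_, ⟨u, hu, rfl⟩, .head' (step_eq M _ _ _) (reaches_rotate M (M (l v)) v u [])⟩
  | halt => exact ⟨(none, _), by simp [Represents], .single (step_eq M _ _ _)⟩

theorem respects : Respects (TM2.step M) (machine M).step (Represents M) := by
  rintro ⟨_ | l, v, S⟩ ⟨o, s⟩ h
  · obtain rfl : o = none := h
    rfl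
  · obtain ⟨u, hu, h⟩ := h
    rw [h]
    exact represents_stepAux M (M l) v S u hu

/-- A step keeps the statement, passes to a substatement, or jumps to a label that stays in `S`. -/
theorem next_mem_stmts [Inhabited Λ] {S : Finset Λ} (hS : TM2.Supports M S)
    (p : State K Γ Λ σ) (x : Option (Cell K Γ)) (p' : State K Γ Λ σ)
    (hp : some p.2.1 ∈ TM2.stmts M S) (h : next M p x = some p') :
    some p'.2.1 ∈ TM2.stmts M S := by
  have sub {q q'} (hq : q' ∈ TM2.stmts₁ q) (hp : some q ∈ TM2.stmts M S) :
      some q' ∈ TM2.stmts M S := TM2.stmts_trans hq hp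
  obtain ⟨b, q, v⟩ := p
  have hsub := TM2.stmts_supportsStmt hS hp
  have self {q : TM2.Stmt (fun _ : K => Γ) Λ σ} := TM2.stmts₁_self (q := q)
  cases q <;> cases b <;> cases x <;> simp only [next] at h <;>
    simp only [TM2.SupportsStmt] at hsub <;> try split at h
  all_goals cases h
  -- The alternatives: an unchanged statement, a jump, the continuation of a statement, and a
  -- branch.
  all_goals first
    | exact hp
    | exact some_mem_stmts M (hsub _)
    | refine sub ?_ hp
      simp [TM2.stmts₁, self]
      done
    | rename_i f q₁ q₂
      refine sub ?_ hp
      cases f v <;> simp [TM2.stmts₁, self]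

/-- The order of quantifiers matters: one problem serves all stack contents, which enter through the
prefix only. -/
theorem exists_controlledPCP [Fintype K] [Fintype Γ] [Finite σ] [Inhabited Λ] {S : Finset Λ}
    (hS : TM2.Supports M S) {l : Λ} (hl : l ∈ S) (v : σ) :
    ∃ P : ControlledPCP, ∀ (stk : K → List Γ) (u : List (Cell K Γ)), Encodes stk u →
      (P.Solvable ((none :: u.map some).flatMap oneHot) ↔
        (eval (TM2.step M) ⟨some l, v, stk⟩).Dom) := by
  let p : State K Γ Λ σ → Prop := fun q => some q.2.1 ∈ TM2.stmts M S
  have : Finite {q // p q} :=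
    Finite.of_injective
      (fun q => (q.1.1, ⟨_, q.2⟩, q.1.2.2) : {q // p q} → Bool × TM2.stmts M S × σ) (by
        rintro ⟨⟨a, b, c⟩, h⟩ ⟨⟨a', b', c'⟩, h'⟩ h
        simpa using h)
  have := Fintype.ofFinite {q // p q}
  refine ⟨((machine M).restrict p fun q a q' => next_mem_stmts M hS q a q').toControlledPCP
    ⟨(false, M l, v), some_mem_stmts M hl⟩, fun stk u hu => ?_⟩
  rw [QueueMachine.solvable_toControlledPCP _ _ (List.cons_ne_nil _ _)]
  exact (QueueMachine.eval_restrict_dom _ _ _ _ _ _).trans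
    (tr_eval_dom (respects M) ⟨u, hu, rfl⟩)

end StackQueue

open Turing PartrecToTM2 StackQueue

/-! ### Binary representations of the inputs -/

/-- The symbol for a bit. -/
def bitSymbol (b : Bool) : Γ' := bif b then .bit1 else .bit0

/-- The binary representation of a positive number, the least significant bit first. -/
def posBits : PosNum → List Bool
  | .one => [true]
  | .bit0 n => false :: posBits n
  | .bit1 n => true :: posBits n

/-- The successor in binary representation. -/
def incBits (l : List Bool) : List Bool :=
  List.recOn l [true] fun b l ih => bif b then false :: ih else true :: l

/-- The binary representation of a natural number, the least significant bit first. -/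
def natBits (n : ℕ) : List Bool := Nat.rec [] (fun _ l => incBits l) n

theorem posBits_succ : ∀ n : PosNum, posBits n.succ = incBits (posBits n)
  | .one => rfl
  | .bit0 _ => rfl
  | .bit1 n => congrArg (List.cons false) (posBits_succ n)

theorem trPosNum_eq : ∀ n : PosNum, trPosNum n = (posBits n).map bitSymbol
  | .one => rfl
  | .bit0 n => congrArg (List.cons Γ'.bit0) (trPosNum_eq n)
  | .bit1 n => congrArg (List.cons Γ'.bit1) (trPosNum_eq n)

/-- `trNat` is defined through `Num`; `natBits` is a recursion on the number itself, from which
primitive recursiveness can be read off. -/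
theorem trNat_eq (n : ℕ) : trNat n = (natBits n).map bitSymbol := by
  suffices h : ∀ n : ℕ, (∃ p : PosNum, (n : Num) = .pos p ∧ natBits n = posBits p) ∨
      ((n : Num) = .zero ∧ natBits n = []) by
    rcases h n with ⟨p, h₁, h₂⟩ | ⟨h₁, h₂⟩ <;> rw [trNat, h₁, h₂, trNum]
    · exact trPosNum_eq p
    · rfl
  intro n
  induction n with
  | zero => exact .inr ⟨rfl, rfl⟩
  | succ n ih =>
    left
    rw [Nat.cast_succ, Num.add_one]
    rcases ih with ⟨p, h₁, h₂⟩ | ⟨h₁, h₂⟩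
    · exact ⟨p.succ, by rw [h₁]; rfl, by rw [posBits_succ, ← h₂]; rfl⟩
    · exact ⟨.one, by rw [h₁]; rfl, congrArg incBits h₂⟩

theorem primrec_incBits : Primrec incBits := by
  refine Primrec.list_rec Primrec.id (Primrec.const _) (h := fun _ p =>
    bif p.1 then false :: p.2.2 else true :: p.2.1) ?_
  refine Primrec.cond (Primrec.fst.comp Primrec.snd) ?_ ?_
  · exact Primrec.list_cons.comp (Primrec.const _)
      (Primrec.snd.comp (Primrec.snd.comp Primrec.snd))
  · exact Primrec.list_cons.comp (Primrec.const _)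
      (Primrec.fst.comp (Primrec.snd.comp Primrec.snd))

theorem primrec_natBits : Primrec natBits :=
  Primrec.nat_rec₁ [] (primrec_incBits.comp₂ Primrec₂.right)

/-! ### The reduction from the halting problem -/

instance : Fintype K' :=
  ⟨{.main, .rev, .aux, .stack}, by rintro (_ | _) <;> simp⟩

/-- The cells for the stacks with the given input. -/
def inputCells (n : ℕ) : List (Cell K' Γ') :=
  (trList [n]).map fun a => some (.main, a)

theorem encodes_inputCells (n : ℕ) :
    Encodes (K'.elim (trList [n]) [] [] []) (inputCells n) := by
  intro k
  rw [inputCells, List.filterMap_map]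
  cases k
  · exact (List.filterMap_congr fun a _ => proj_self _ a).trans List.filterMap_some
  all_goals exact List.filterMap_eq_nil_iff.2 fun a _ => proj_of_ne (by simp) a

/-- The letter of the queue for a symbol on the main stack. -/
def mainLetter (a : Γ') : Option (Cell K' Γ') := some (some (.main, a))

/-- The code of the initial queue. -/
noncomputable def inputBits (n : ℕ) : List Bool :=
  (none :: (inputCells n).map some : List (Option (Cell K' Γ'))).flatMap oneHot

theorem primrec_inputBits : Primrec inputBits := by
  have (n : ℕ) : inputBits n =
      (oneHot (none : Option (Cell K' Γ')) ++
        (natBits n).flatMap fun b => oneHot (mainLetter (bitSymbol b))) ++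
        oneHot (mainLetter .cons) := by
    simp [inputBits, inputCells, trNat_eq, List.flatMap_map, mainLetter]
  refine Primrec.of_eq ?_ fun n => (this n).symm
  refine Primrec.list_append.comp (Primrec.list_append.comp (Primrec.const _)
    (Primrec.list_flatMap primrec_natBits ?_)) (Primrec.const _)
  exact (Primrec.dom_finite fun b : Bool => oneHot (mainLetter (bitSymbol b))).comp₂
    Primrec₂.right

/-- The code computes the universal function that runs the `n`-th program on `0`; deciding its
domain would decide `ComputablePred.halting_problem`. -/
theorem exists_code_not_computablePred :
    ∃ c : ToPartrec.Code, ¬ ComputablePred fun n : ℕ => (c.eval [n]).Dom := by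
  have hF : Partrec fun n : ℕ => Nat.Partrec.Code.eval (Denumerable.ofNat _ n) 0 :=
    Nat.Partrec.Code.eval_part.comp (Computable.ofNat _) (Computable.const 0)
  obtain ⟨c, hc⟩ := ToPartrec.Code.exists_code (Nat.Partrec'.part_iff₁.2 hF)
  refine ⟨c, fun h => ComputablePred.halting_problem 0 ?_⟩
  obtain ⟨f, hf, hfc⟩ := ComputablePred.computable_iff.1 h
  refine ComputablePred.computable_iff.2 ⟨fun d => f (Encodable.encode d),
    hf.comp Computable.encode, funext fun d => ?_⟩
  rw [← congrFun hfc (Encodable.encode d)]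
  have := hc ⟨[Encodable.encode d], rfl⟩
  rw [show c.eval [Encodable.encode d] = _ from this]
  simp [List.Vector.head]

theorem exists_undecidable_controlledPCP :
    ∃ (P : ControlledPCP) (s : ℕ → List Bool), Primrec s ∧
      ¬ ComputablePred fun n => P.Solvable (s n) := by
  obtain ⟨c, hc⟩ := exists_code_not_computablePred
  have hS := tr_supports c .halt
  -- `TM2.Supports` refers to the default label, so the instance has to name the initial label of
  -- `c`; `hS.1` then says that it belongs to the finite support.
  obtain ⟨P, hP⟩ := @exists_controlledPCP _ _ _ _ _ tr _ _ _
    ⟨PartrecToTM2.trNormal c .halt⟩ _ hS _ hS.1 none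
  refine ⟨P, _, primrec_inputBits, fun h => hc (h.of_eq fun n => ?_)⟩
  rw [inputBits, hP _ _ (encodes_inputCells n)]
  have := tr_eval c [n]
  rw [init] at this
  erw [this]
  rfl

end SyGuS

theorem mainTheorem5 :
    (SyGuS.Undecidable SyGuS.CFInstance.code
        (fun I => I.GeneratesTerms)
        SyGuS.CFInstance.HasSolution ∧
      SyGuS.Undecidable SyGuS.CFInstance.code
        (fun I => I.GeneratesTerms ∧ I.ConcatEq)
        SyGuS.CFInstance.HasSolution) ∧
    (SyGuS.Undecidable SyGuS.TreeInstance.code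
        (fun _ => True)
        SyGuS.TreeInstance.HasSolution ∧
      SyGuS.Undecidable SyGuS.TreeInstance.code
        (fun I => I.ConcatEq)
        SyGuS.TreeInstance.HasSolution) := by
  obtain ⟨P, s, hs, h⟩ := SyGuS.exists_undecidable_controlledPCP
  have hcf := P.undecidable_cfInstance hs h
  have htree := P.undecidable_treeInstance hs h
  -- A procedure for all instances would in particular handle those of the fragment.
  exact ⟨⟨hcf.mono fun _ hI => hI.1, hcf⟩, ⟨htree.mono fun _ _ => trivial, htree⟩⟩
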